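/- Let $D$ be an oriented knot diagram with $N\ge 1$ crossings. Travelling along the knot, index the arcs (maximal pieces between consecutive under-passages) $\mathfrak a_1,\dots,\mathfrak a_N$ and the crossings $c_1,\dots,c_N$ so that $\mathfrak a_n$ ends and $\mathfrak a_{n+1}$ begins at $c_n$; indices are read modulo $N$. Let $\mathfrak a_{o(n)}$ be the over-arc at $c_n$. For $a=\binom{x}{y}\in\mathbb C^2$ put $M(a)=\begin{pmatrix}1-xy&x^2\\-y^2&1+xy\end{pmatrix}\in SL_2(\mathbb C)$, and for $a,b\in\mathbb C^2$ put $a\rhd b=M(b)^{-1}a$, $a\lhd b=M(b)a$ and $\langle a,b\rangle=\det(a\ b)$. Let $R_{par}$ be the set of $N$-tuples $(A_1,\dots,A_N)$ of trace-$2$ matrices in $SL_2(\mathbb C)$, not all equal, which satisfy the Wirtinger relations of $D$: $A_{n+1}=A_{o(n)}^{-1}A_nA_{o(n)}$ if $c_n$ is positive and $A_{n+1}=A_{o(n)}A_nA_{o(n)}^{-1}$ if $c_n$ is negative. Let $X_{par}$ be the quotient of $R_{par}$ by simultaneous conjugation, with the quotient of the Zariski topology, and let $X_{par}^{(0)}$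 be its zero-dimensional part, i.e. the (finite) set of points that are irreducible components of $X_{par}$ (so $X_{par}^{(0)}=X_{par}$ when $X_{par}$ is zero-dimensional). A sign-type is $\epsilon=(\epsilon_1,\dots,\epsilon_N)\in\{\pm1\}^N$, and its total sign is $\epsilon_1\cdots\epsilon_N$. Let $\mathcal Q_\epsilon$ be the set of arc-colorings of sign-type $\epsilon$: tuples $a=(a_1,\dots,a_N)\in(\mathbb C^2)^N$ with $(M(a_1),\dots,M(a_N))\in R_{par}$ and, for every $n$, $\epsilon_n a_{n+1}=a_n\rhd a_{o(n)}$ if $c_n$ is positive and $\epsilon_n a_{n+1}=a_n\lhd a_{o(n)}$ if $c_n$ is negative. Let $\widetilde{\mathcal Q}_\epsilon$ be its quotient by simultaneous left multiplication by $SL_2(\mathbb C)$; the map $\widetilde{\mathcal Q}_\epsilon\to X_{par}$ induced by $M$ is injective and $\langle a_i,a_j\rangle$ is well defined on $\widetilde{\mathcal Q}_\epsilon$. The $u$-polynomial of $D$ at the arcs $\mathfrak a_i,\mathfrak a_j$ for the sign-type $\epsilon$ is $$g^{\epsilon}_{ij}(u)=\prod_{[a]}\bigl(u-\langle a_i,a_j\rangle\bigr)\in\mathbb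 C[u],$$ the product over all $[a]\in\widetilde{\mathcal Q}_\epsilon$ whose image lies in $X_{par}^{(0)}$. For a polynomial $g$ write $g^*(u)=(-1)^{\deg g}g(-u)$. **Theorem.** Let $\epsilon$ and $\epsilon'$ be two sign-types with the same total sign, $\epsilon_1\cdots\epsilon_N=\epsilon'_1\cdots\epsilon'_N$. Then for all integers $i\le j$ (indices modulo $N$) $$g^{\epsilon'}_{ij}(u)=\begin{cases}g^{\epsilon}_{ij}(u)&\text{if }\ \epsilon_i\epsilon_{i+1}\cdots\epsilon_{j-1}=+\,\epsilon'_i\epsilon'_{i+1}\cdots\epsilon'_{j-1},\\[2pt](g^{\epsilon}_{ij})^*(u)&\text{if }\ \epsilon_i\epsilon_{i+1}\cdots\epsilon_{j-1}=-\,\epsilon'_i\epsilon'_{i+1}\cdots\epsilon'_{j-1}.\end{cases}$$ -/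

import Mathlib

open Polynomial

/-- A signed Gauss code with `N` crossings.  Travelling once along an oriented knot diagram one
meets `2 * N` passages, numbered by `Fin (2 * N)`; `passage (Sum.inl c)` is the under-passage and
`passage (Sum.inr c)` the over-passage of the crossing `c`.  Crossings are numbered (modulo `N`) in
the order in which their under-passages are met.  Planarity is imposed in `OrientedKnotDiagram`. -/
structure GaussCode (N : ℕ) where
  passage : ZMod N ⊕ ZMod N ≃ Fin (2 * N)
  /-- crossings are numbered in the order of their under-passages -/
  under_lt : ∀ c d : ZMod N, c.val < d.val → passage (Sum.inl c) < passage (Sum.inl d)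
  /-- the sign (positive or negative crossing) -/
  sign : ZMod N → ℤˣ

namespace GaussCode

variable {N : ℕ} (D : GaussCode N)

/-- The passage that follows a given passage along the oriented knot. -/
def next : Equiv.Perm (ZMod N ⊕ ZMod N) :=
  (D.passage.trans (finRotate (2 * N))).trans D.passage.symm

/-- Half-edges of the underlying 4-valent graph: `(s, true)` is the half-edge leaving the passage
`s`, `(s, false)` the half-edge arriving at it. -/
abbrev Dart (N : ℕ) : Type := (ZMod N ⊕ ZMod N) × Bool

/-- The other half of the edge of a half-edge: an edge leaves a passage and arrives at the next. -/
def edgeFlip : Dart N → Dart N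
  | (s, true) => (D.next s, false)
  | (s, false) => (D.next.symm s, true)

/-- The counterclockwise next half-edge at the same crossing.  Counterclockwise one meets
over-out, under-out, over-in, under-in at a positive crossing, and
over-out, under-in, over-in, under-out at a negative one. -/
def rotate : Dart N → Dart N
  | (Sum.inr c, b) => (Sum.inl c, if D.sign c = 1 then b else !b)
  | (Sum.inl c, b) => (Sum.inr c, if D.sign c = 1 then !b else b)

/-- The clockwise next half-edge at the same crossing. -/
def rotateInv : Dart N → Dart N
  | (Sum.inl c, b) => (Sum.inr c, if D.sign c = 1 then b else !b)
  | (Sum.inr c, b) => (Sum.inl c, if D.sign c = 1 then !b else b)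

/-- The permutation of half-edges whose cycles are the boundaries of the faces. -/
def facePerm : Equiv.Perm (Dart N) where
  toFun d := D.rotate (D.edgeFlip d)
  invFun d := D.edgeFlip (D.rotateInv d)
  left_inv := by
    have h1 : ∀ d, D.rotateInv (D.rotate d) = d := by
      rintro ⟨c | c, b⟩ <;> by_cases h : D.sign c = 1 <;> simp [rotate, rotateInv, h]
    have h2 : ∀ d, D.edgeFlip (D.edgeFlip d) = d := by
      rintro ⟨s, _ | _⟩ <;> simp [edgeFlip]
    intro d
    simp only [h1, h2]
  right_inv := by
    have h1 : ∀ d, D.rotate (D.rotateInv d) = d := by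
      rintro ⟨c | c, b⟩ <;> by_cases h : D.sign c = 1 <;> simp [rotate, rotateInv, h]
    have h2 : ∀ d, D.edgeFlip (D.edgeFlip d) = d := by
      rintro ⟨s, _ | _⟩ <;> simp [edgeFlip]
    intro d
    simp only [h1, h2]

/-- The faces of the diagram on its supporting surface. -/
def Face : Type := Quotient (Equiv.Perm.SameCycle.setoid D.facePerm)

/-- The over-arc at the crossing `c`.  The arc `k` runs from the under-passage of `k - 1` to
the under-passage of `k`, so an over-passage lies on the arc whose number is, modulo `N`, the
number of under-passages met before it. -/
noncomputable def overArc (c : ZMod N) : ZMod N :=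
  (Nat.card {k : ZMod N // D.passage (Sum.inl k) < D.passage (Sum.inr c)} : ZMod N)

end GaussCode

/-- Oriented knot diagrams with `N` crossings: signed Gauss codes for which the supporting closed
surface is a sphere, i.e. `N - 2 * N + #faces = 2`.  The arc `k` (`k : ZMod N`) ends at the
crossing `k`, where the arc `k + 1` begins. -/
structure OrientedKnotDiagram (N : ℕ) extends GaussCode N where
  planar : Nat.card toGaussCode.Face = N + 2

namespace ParabolicQuandle

open Matrix

abbrev SL2C : Type := Matrix.SpecialLinearGroup (Fin 2) ℂ

/-- The parabolic quandle map
`(x, y) ↦ !![1 - x * y, x ^ 2; -y ^ 2, 1 + x * y]`. -/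
def pmap (a : Fin 2 → ℂ) : SL2C :=
  ⟨!![1 - a 0 * a 1, a 0 ^ 2; -(a 1) ^ 2, 1 + a 0 * a 1], by
    rw [Matrix.det_fin_two_of]; ring⟩

/-- `a ▹ b = M(b)⁻¹ a`. -/
def qr (a b : Fin 2 → ℂ) : Fin 2 → ℂ := ((pmap b)⁻¹).1 *ᵥ a

/-- `a ◃ b = M(b) a`, the inverse operation. -/
def ql (a b : Fin 2 → ℂ) : Fin 2 → ℂ := (pmap b).1 *ᵥ a

/-- The symplectic form `⟨a, b⟩ = det (a, b)` with `a`, `b` as columns. -/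
def symp (a b : Fin 2 → ℂ) : ℂ := Matrix.det !![a 0, b 0; a 1, b 1]

variable {N : ℕ} (D : OrientedKnotDiagram N)

/-- Parabolic representations: tuples of `SL(2, ℂ)`-matrices of trace `2`, one for each
arc (Wirtinger generator), that satisfy the Wirtinger relations and are not all equal. -/
def RPar : Set (ZMod N → SL2C) :=
  {A | (∀ k, (A k).1.trace = 2) ∧
    (∀ n, A (n + 1) =
      if D.sign n = 1 then (A (D.overArc n))⁻¹ * A n * A (D.overArc n)
      else A (D.overArc n) * A n * (A (D.overArc n))⁻¹) ∧
    ∃ i j, A i ≠ A j}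

/-- Conjugacy of representations. -/
def conjSetoid : Setoid (RPar D) where
  r A B := ∃ g : SL2C, ∀ k, g * A.1 k * g⁻¹ = B.1 k
  iseqv :=
    { refl := fun A => ⟨1, by simp⟩
      symm := by
        rintro A B ⟨g, hg⟩
        exact ⟨g⁻¹, fun k => by rw [← hg k]; group⟩
      trans := by
        rintro A B C ⟨g, hg⟩ ⟨h, hh⟩
        exact ⟨h * g, fun k => by rw [← hh k, ← hg k]; group⟩ }

/-- The variety of parabolic representations up to conjugation (set-theoretically the same as up
to equality of characters, since non-abelian parabolic representations are irreducible). -/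
def XPar : Type := Quotient (conjSetoid D)

/-- The affine coordinates (matrix entries) of a representation. -/
def RPar.coords (A : RPar D) : ZMod N × Fin 2 × Fin 2 → ℂ :=
  fun p => (A.1 p.1).1 p.2.1 p.2.2

/-- The Zariski topology on a set of representations, as a subset of affine space. -/
@[reducible] noncomputable def RPar.zariski : TopologicalSpace (RPar D) :=
  TopologicalSpace.induced
    (fun A => MvPolynomial.pointToPoint (k := ℂ) (RPar.coords D A)) inferInstance

/-- The Zariski topology on the quotient. -/
noncomputable instance XPar.zariski : TopologicalSpace (XPar D) :=
  TopologicalSpace.coinduced (Quotient.mk (conjSetoid D)) (RPar.zariski D)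

/-- The zero-dimensional part of `XPar D`: the union of the irreducible components that are
points. -/
def XPar.zeroDim : Set (XPar D) := {x | {x} ∈ irreducibleComponents (XPar D)}

theorem XPar.zeroDim_finite [NeZero N] : (XPar.zeroDim D).Finite := by
  let _ : TopologicalSpace (RPar D) := RPar.zariski D
  have h1 : TopologicalSpace.NoetherianSpace (RPar D) :=
    Topology.IsInducing.noetherianSpace (Topology.IsInducing.mk rfl :
      Topology.IsInducing (fun A => MvPolynomial.pointToPoint (k := ℂ) (RPar.coords D A)))
  have hc : Continuous (Quotient.mk (conjSetoid D) : RPar D → XPar D) :=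
    continuous_iff_coinduced_le.mpr le_rfl
  have h2 : TopologicalSpace.NoetherianSpace (XPar D) :=
    TopologicalSpace.noetherianSpace_of_surjective _ hc Quotient.mk_surjective
  exact Set.Finite.preimage (Set.singleton_injective.injOn)
    (TopologicalSpace.NoetherianSpace.finite_irreducibleComponents (α := XPar D))

/-- The parabolic quandle system with sign-type `ε`: arc-colorings of sign-type `ε` whose
associated representation is parabolic. -/
def QSys (ε : ZMod N → ℤˣ) : Set (ZMod N → Fin 2 → ℂ) :=
  {a | (fun k => pmap (a k)) ∈ RPar D ∧
    ∀ n, (((ε n : ℤˣ) : ℤ) : ℂ) • a (n + 1) =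
      if D.sign n = 1 then qr (a n) (a (D.overArc n)) else ql (a n) (a (D.overArc n))}

/-- Two arc-colorings are equivalent if they differ by left multiplication by an element of
`SL(2, ℂ)`. -/
def colorSetoid (ε : ZMod N → ℤˣ) : Setoid (QSys D ε) where
  r a b := ∃ g : SL2C, ∀ k, g.1 *ᵥ a.1 k = b.1 k
  iseqv :=
    { refl := fun a => ⟨1, by simp⟩
      symm := by
        rintro a b ⟨g, hg⟩
        refine ⟨g⁻¹, fun k => ?_⟩
        rw [← hg k, Matrix.mulVec_mulVec, ← Matrix.SpecialLinearGroup.coe_mul]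
        simp
      trans := by
        rintro a b c ⟨g, hg⟩ ⟨h, hh⟩
        refine ⟨h * g, fun k => ?_⟩
        rw [← hh k, ← hg k, Matrix.mulVec_mulVec, Matrix.SpecialLinearGroup.coe_mul] }

/-- Classes of arc-colorings of sign-type `ε`. -/
def QClass (ε : ZMod N → ℤˣ) : Type := Quotient (colorSetoid D ε)

theorem pmap_mulVec (g : SL2C) (a : Fin 2 → ℂ) : pmap (g.1 *ᵥ a) = g * pmap a * g⁻¹ := by
  have hd := g.2
  rw [Matrix.det_fin_two] at hd
  ext i j
  rw [Matrix.SpecialLinearGroup.coe_mul, Matrix.SpecialLinearGroup.coe_mul,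
    Matrix.SpecialLinearGroup.coe_inv, Matrix.adjugate_fin_two]
  fin_cases i <;> fin_cases j <;>
    simp [pmap, Matrix.mul_apply, Fin.sum_univ_two, Matrix.mulVec, dotProduct]
  · linear_combination -hd
  · ring
  · ring
  · linear_combination -hd

theorem eq_or_eq_neg_of_pmap_eq {a b : Fin 2 → ℂ} (h : pmap a = pmap b) : a = b ∨ a = -b := by
  have e00 := congrArg (fun A : SL2C => A.1 0 0) h
  have e01 := congrArg (fun A : SL2C => A.1 0 1) h
  have e10 := congrArg (fun A : SL2C => A.1 1 0) h
  simp only [pmap, Matrix.of_apply, Matrix.cons_val', Matrix.cons_val_zero,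
    Matrix.cons_val_one, Matrix.cons_val_fin_one] at e00 e01 e10
  have key : ∀ c : ℂ, c * c = 1 → a 0 = c * b 0 → a 1 = c * b 1 → a = b ∨ a = -b := by
    intro c hc h0 h1
    rcases mul_self_eq_one_iff.mp hc with rfl | rfl
    · left; ext k; fin_cases k <;> simp_all
    · right; ext k; fin_cases k <;> simp_all
  rcases sq_eq_sq_iff_eq_or_eq_neg.mp e01 with h0 | h0
  · by_cases hz : b 0 = 0
    · rcases sq_eq_sq_iff_eq_or_eq_neg.mp (neg_injective e10) with h1 | h1
      · exact key 1 (by ring) (by simp [h0]) (by simp [h1])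
      · exact key (-1) (by ring) (by simp [h0, hz]) (by simp [h1])
    · refine key 1 (by ring) (by simp [h0]) ?_
      apply mul_left_cancel₀ hz
      rw [h0] at e00
      linear_combination -e00
  · by_cases hz : b 0 = 0
    · rcases sq_eq_sq_iff_eq_or_eq_neg.mp (neg_injective e10) with h1 | h1
      · exact key 1 (by ring) (by simp [h0, hz]) (by simp [h1])
      · exact key (-1) (by ring) (by simp [h0]) (by simp [h1])
    · refine key (-1) (by ring) (by simp [h0]) ?_
      apply mul_left_cancel₀ hz
      rw [h0] at e00
      linear_combination e00

theorem symp_mulVec (g : SL2C) (a b : Fin 2 → ℂ) : symp (g.1 *ᵥ a) (g.1 *ᵥ b) = symp a b := by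
  have hd := g.2
  rw [Matrix.det_fin_two] at hd
  simp only [symp, Matrix.det_fin_two_of, Matrix.mulVec, dotProduct, Fin.sum_univ_two]
  linear_combination (a 0 * b 1 - b 0 * a 1) * hd

/-- The map induced on classes by sending an arc-coloring to its associated representation. -/
def QClass.toXPar (ε : ZMod N → ℤˣ) : QClass D ε → XPar D :=
  Quotient.map' (s₁ := colorSetoid D ε) (s₂ := conjSetoid D)
    (fun a => ⟨fun k => pmap (a.1 k), a.2.1⟩)
    (by
      rintro a b ⟨g, hg⟩
      exact ⟨g, fun k => by simp only [← hg k, pmap_mulVec]⟩)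

theorem QClass.toXPar_injective [NeZero N] (ε : ZMod N → ℤˣ) :
    Function.Injective (QClass.toXPar D ε) := by
  rintro ⟨a⟩ ⟨b⟩ hab
  obtain ⟨g, hg⟩ := Quotient.exact hab
  have hp : ∀ k, pmap (g.1 *ᵥ a.1 k) = pmap (b.1 k) := fun k => by
    rw [pmap_mulVec]; exact hg k
  obtain ⟨s, hs, h0⟩ : ∃ s : ℂ, (s = 1 ∨ s = -1) ∧ g.1 *ᵥ a.1 0 = s • b.1 0 := by
    rcases eq_or_eq_neg_of_pmap_eq (hp 0) with h | h
    · exact ⟨1, Or.inl rfl, by simpa using h⟩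
    · exact ⟨-1, Or.inr rfl, by simpa using h⟩
  have step : ∀ n, g.1 *ᵥ a.1 n = s • b.1 n → g.1 *ᵥ a.1 (n + 1) = s • b.1 (n + 1) := by
    intro n hn
    have h1 := a.2.2 n
    have h2 := b.2.2 n
    have hM : ∀ k, g * pmap (a.1 k) = pmap (b.1 k) * g := fun k => by
      rw [← hp k, pmap_mulVec]; group
    have hMi : ∀ k, g * (pmap (a.1 k))⁻¹ = (pmap (b.1 k))⁻¹ * g := fun k => by
      rw [← hp k, pmap_mulVec]; group
    have hu : (((ε n : ℤˣ) : ℤ) : ℂ) ≠ 0 := by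
      rcases Int.units_eq_one_or (ε n) with h | h <;> simp [h]
    have h3 : (((ε n : ℤˣ) : ℤ) : ℂ) • (g.1 *ᵥ a.1 (n + 1)) =
        (((ε n : ℤˣ) : ℤ) : ℂ) • (s • b.1 (n + 1)) := by
      rw [smul_comm _ s, h2, ← Matrix.mulVec_smul, h1]
      split_ifs
      · rw [qr, qr, Matrix.mulVec_mulVec, ← Matrix.SpecialLinearGroup.coe_mul, hMi,
          Matrix.SpecialLinearGroup.coe_mul, ← Matrix.mulVec_mulVec, hn, Matrix.mulVec_smul]
      · rw [ql, ql, Matrix.mulVec_mulVec, ← Matrix.SpecialLinearGroup.coe_mul, hM,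
          Matrix.SpecialLinearGroup.coe_mul, ← Matrix.mulVec_mulVec, hn, Matrix.mulVec_smul]
    exact smul_right_injective _ hu h3
  have hnat : ∀ m : ℕ, g.1 *ᵥ a.1 (m : ZMod N) = s • b.1 (m : ZMod N) := by
    intro m
    induction m with
    | zero => simpa using h0
    | succ m ih => simpa using step _ ih
  have hall : ∀ k, g.1 *ᵥ a.1 k = s • b.1 k := fun k => by
    simpa using hnat k.val
  apply Quotient.sound
  rcases hs with rfl | rfl
  · exact ⟨g, fun k => by simpa using hall k⟩
  · refine ⟨-g, fun k => ?_⟩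
    have := hall k
    simp only [Matrix.SpecialLinearGroup.coe_neg, Matrix.neg_mulVec]
    rw [this]; simp

/-- The `u`-value `⟨a_i, a_j⟩` of a class of arc-colorings of sign-type `ε`. -/
def uValue (ε : ZMod N → ℤˣ) (i j : ZMod N) : QClass D ε → ℂ :=
  Quotient.lift (s := colorSetoid D ε) (fun a => symp (a.1 i) (a.1 j))
    (by
      rintro a b ⟨g, hg⟩
      simp only [← hg, symp_mulVec])

theorem QClass.zeroDim_finite [NeZero N] (ε : ZMod N → ℤˣ) :
    {q : QClass D ε | QClass.toXPar D ε q ∈ XPar.zeroDim D}.Finite :=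
  Set.Finite.preimage (QClass.toXPar_injective D ε).injOn (XPar.zeroDim_finite D)

/-- The `u`-polynomial at the arcs `i`, `j` for the sign-type `ε`: the product of
`u - ⟨a_i, a_j⟩` over the classes in the zero-dimensional part of `XPar D` that have an
arc-coloring `a` of sign-type `ε`. -/
noncomputable def uPoly [NeZero N] (ε : ZMod N → ℤˣ) (i j : ZMod N) : ℂ[X] :=
  ∏ q ∈ (QClass.zeroDim_finite D ε).toFinset, (X - C (uValue D ε i j q))

/-- `g^*(u) = (-1)^{deg g} g(-u)`. -/
noncomputable def starPoly (g : ℂ[X]) : ℂ[X] := (-1) ^ g.natDegree * g.comp (-X)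

end ParabolicQuandle

namespace ParabolicQuandle

open Matrix

variable {N : ℕ}

/-! The entries of `M(a)` are even in `a`, so replacing each `a_k` by `s_k a_k` with `s_k = ±1` does
not change the underlying representation. At a crossing the over-arc enters only through `M`, and
the operation is linear in the under-arc. The rescaling therefore carries sign-type `ε` to `ε'` as
soon as `s_{n+1} = s_n ε_n ε'_n` for all `n`. This recursion closes up around the knot because `ε`
and `ε'` have equal total signs (`exists_cyclic_primitive`). Rescaling then matches the two sets of
classes over the same points of `XPar` and multiplies every `⟨a_i, a_j⟩` by the one sign `s_i s_j`,
which telescopes to the product of `ε_k ε'_k` over `i ≤ k < j`. So the roots are all kept or all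
negated. -/

theorem pmap_units_smul (s : ℤˣ) (a : Fin 2 → ℂ) : pmap (((s : ℤ) : ℂ) • a) = pmap a := by
  apply Subtype.ext
  rcases Int.units_eq_one_or s with rfl | rfl <;> simp [pmap]

theorem prod_range_natCast_zmod [NeZero N] {M : Type*} [CommMonoid M] (f : ZMod N → M) :
    ∏ k ∈ Finset.range N, f (k : ZMod N) = ∏ k, f k := by
  refine Finset.prod_nbij' (fun k => (k : ZMod N)) ZMod.val ?_ ?_ ?_ ?_ ?_
  · simp
  · simp [ZMod.val_lt]
  · intro k hk
    exact ZMod.val_cast_of_lt (Finset.mem_range.mp hk)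
  · simp
  · simp

/-- A function on a cycle with trivial total product is a multiplicative difference. -/
theorem exists_cyclic_primitive [NeZero N] (d : ZMod N → ℤˣ) (hd : ∏ k, d k = 1) :
    ∃ s : ZMod N → ℤˣ, ∀ n, s (n + 1) = s n * d n := by
  refine ⟨fun n => ∏ k ∈ Finset.range n.val, d (k : ZMod N), fun n => ?_⟩
  have hn : (∏ k ∈ Finset.range n.val, d (k : ZMod N)) * d n =
      ∏ k ∈ Finset.range (n.val + 1), d (k : ZMod N) := by
    rw [Finset.prod_range_succ, ZMod.natCast_zmod_val]
  have hv : (n + 1).val = (n.val + 1) % N := by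
    rw [← ZMod.val_natCast, Nat.cast_add, ZMod.natCast_zmod_val, Nat.cast_one]
  simp only [hn, hv]
  rcases Nat.lt_or_ge (n.val + 1) N with h | h
  · rw [Nat.mod_eq_of_lt h]
  -- Wrap-around: the representative of `n + 1` is `0`, so its product is empty, while the recursion
  -- gives the product over the whole cycle. This is where `hd` is needed.
  · have : n.val + 1 = N := le_antisymm (ZMod.val_lt n) h
    rw [this, Nat.mod_self, prod_range_natCast_zmod, hd, Finset.prod_range_zero]

/-- Telescoping is done over integers rather than residues, so the interval may wind around the
cycle any number of times. -/
theorem cyclic_primitive_eq_mul_prod_Ico {d s : ZMod N → ℤˣ} (h : ∀ n, s (n + 1) = s n * d n)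
    {i j : ℤ} (hij : i ≤ j) :
    s (j : ZMod N) = s (i : ZMod N) * ∏ k ∈ Finset.Ico i j, d (k : ZMod N) := by
  induction j, hij using Int.leInduction with
  | base => simp
  | succ j hij ih =>
    have : Finset.Ico i (j + 1) = insert j (Finset.Ico i j) := by
      ext k; simp only [Finset.mem_Ico, Finset.mem_insert]; omega
    rw [this, Finset.prod_insert (by simp), Int.cast_add, Int.cast_one, h, ih]
    exact (mul_assoc _ _ _).trans (congrArg _ (mul_comm _ _))

variable (D : OrientedKnotDiagram N) {ε ε' : ZMod N → ℤˣ} {s : ZMod N → ℤˣ}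

theorem units_smul_mem_QSys (h : ∀ n, s (n + 1) = s n * (ε n * ε' n))
    {a : ZMod N → Fin 2 → ℂ} (ha : a ∈ QSys D ε) :
    (fun k => ((s k : ℤ) : ℂ) • a k) ∈ QSys D ε' := by
  refine ⟨by simpa only [pmap_units_smul] using ha.1, fun n => ?_⟩
  have hs : (((ε' n : ℤˣ) : ℤ) : ℂ) * ((s (n + 1) : ℤ) : ℂ) =
      ((s n : ℤ) : ℂ) * (((ε n : ℤˣ) : ℤ) : ℂ) := by
    have : ε' n * s (n + 1) = s n * ε n := by
      rw [h, ← mul_assoc (s n), mul_comm (ε' n), mul_assoc, Int.units_mul_self, mul_one]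
    exact_mod_cast congrArg (fun u : ℤˣ => (u : ℤ)) this
  have ha' := ha.2 n
  -- The sign of the over-arc disappears inside `pmap`; the sign of the under-arc comes out by
  -- linearity.
  simp only [qr, ql, pmap_units_smul, Matrix.mulVec_smul] at ha' ⊢
  rw [smul_smul, hs, ← smul_smul, ha', smul_ite]

/-- Changing the signs of an arc-coloring arc by arc, on classes. -/
def QClass.twist (h : ∀ n, s (n + 1) = s n * (ε n * ε' n)) : QClass D ε → QClass D ε' :=
  Quotient.map' (s₁ := colorSetoid D ε) (s₂ := colorSetoid D ε')
    (fun a => ⟨fun k => ((s k : ℤ) : ℂ) • a.1 k, units_smul_mem_QSys D h a.2⟩)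
    (by
      rintro a b ⟨g, hg⟩
      exact ⟨g, fun k => by simp only [Matrix.mulVec_smul, hg]⟩)

/-- Twisting covers the identity of `XPar`. Hence it respects the zero-dimensional part, and
injectivity of `toXPar` reduces statements about twisted classes to their images. -/
theorem QClass.toXPar_twist (h : ∀ n, s (n + 1) = s n * (ε n * ε' n)) (q : QClass D ε) :
    QClass.toXPar D ε' (QClass.twist D h q) = QClass.toXPar D ε q := by
  obtain ⟨a⟩ := q
  exact congrArg (Quotient.mk (conjSetoid D))
    (Subtype.ext (funext fun k => pmap_units_smul (s k) (a.1 k)))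

theorem uValue_twist (h : ∀ n, s (n + 1) = s n * (ε n * ε' n)) (i j : ZMod N) (q : QClass D ε) :
    uValue D ε' i j (QClass.twist D h q) = (((s i * s j : ℤˣ) : ℤ) : ℂ) * uValue D ε i j q := by
  obtain ⟨a⟩ := q
  change symp (((s i : ℤ) : ℂ) • a.1 i) (((s j : ℤ) : ℂ) • a.1 j) = _ * symp (a.1 i) (a.1 j)
  simp only [symp, Matrix.det_fin_two_of, Pi.smul_apply, smul_eq_mul, Units.val_mul, Int.cast_mul]
  ring

/-- Twisting multiplies all roots of the `u`-polynomial by the same sign. -/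
theorem uPoly_eq_prod_of_twist [NeZero N] (h : ∀ n, s (n + 1) = s n * (ε n * ε' n))
    (i j : ZMod N) :
    uPoly D ε' i j = ∏ q ∈ (QClass.zeroDim_finite D ε).toFinset,
      (X - C ((((s i * s j : ℤˣ) : ℤ) : ℂ) * uValue D ε i j q)) := by
  -- The recursion is symmetric in `ε` and `ε'`, so the same `s` also twists back.
  have h' : ∀ n, s (n + 1) = s n * (ε' n * ε n) := fun n => by rw [h, mul_comm (ε n)]
  symm
  refine Finset.prod_nbij' (QClass.twist D h) (QClass.twist D h') ?_ ?_ ?_ ?_ ?_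
  · intro q hq
    simpa [QClass.toXPar_twist] using hq
  · intro q hq
    simpa [QClass.toXPar_twist] using hq
  · intro q _
    -- Both composites of the twists lie over the identity of `XPar`, hence are the identity on
    -- classes.
    apply QClass.toXPar_injective D
    rw [QClass.toXPar_twist, QClass.toXPar_twist]
  · intro q _
    apply QClass.toXPar_injective D
    rw [QClass.toXPar_twist, QClass.toXPar_twist]
  · intro q _
    rw [uValue_twist]

theorem starPoly_prod_X_sub_C {ι : Type*} (t : Finset ι) (v : ι → ℂ) :
    starPoly (∏ q ∈ t, (X - C (v q))) = ∏ q ∈ t, (X - C (-v q)) := by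
  -- The degree is the number of factors, so `(-1) ^ deg` supplies one `-1` per factor, and `-(-X -
  -- v) = X + v`.
  rw [starPoly, natDegree_finsetProd_X_sub_C_eq_card, Polynomial.prod_comp, ← Finset.prod_const,
    ← Finset.prod_mul_distrib]
  refine Finset.prod_congr rfl fun q _ => ?_
  simp only [sub_comp, X_comp, C_comp, C_neg]
  ring

end ParabolicQuandle

theorem mainTheorem5 {N : ℕ} [NeZero N] (D : OrientedKnotDiagram N) (ε ε' : ZMod N → ℤˣ)
    (htotal : ∏ k, ε k = ∏ k, ε' k) (i j : ℤ) (hij : i ≤ j) :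
    ((∏ k ∈ Finset.Ico i j, ε (k : ZMod N) = ∏ k ∈ Finset.Ico i j, ε' (k : ZMod N)) →
      ParabolicQuandle.uPoly D ε' i j = ParabolicQuandle.uPoly D ε i j) ∧
    ((∏ k ∈ Finset.Ico i j, ε (k : ZMod N) = -∏ k ∈ Finset.Ico i j, ε' (k : ZMod N)) →
      ParabolicQuandle.uPoly D ε' i j =
        ParabolicQuandle.starPoly (ParabolicQuandle.uPoly D ε i j)) := by
  obtain ⟨s, hs⟩ := ParabolicQuandle.exists_cyclic_primitive (fun k => ε k * ε' k) (by
    rw [Finset.prod_mul_distrib, htotal, Int.units_mul_self])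
  have hsij : s i * s j = (∏ k ∈ Finset.Ico i j, ε (k : ZMod N)) *
      ∏ k ∈ Finset.Ico i j, ε' (k : ZMod N) := by
    -- Since `s i` squares to `1`, the free choice of initial sign drops out.
    rw [ParabolicQuandle.cyclic_primitive_eq_mul_prod_Ico hs hij, ← mul_assoc,
      Int.units_mul_self, one_mul, Finset.prod_mul_distrib]
  rw [ParabolicQuandle.uPoly_eq_prod_of_twist D hs, hsij]
  refine ⟨fun h => ?_, fun h => ?_⟩
  · rw [h, Int.units_mul_self]
    simp [ParabolicQuandle.uPoly]
  · rw [h, neg_mul, Int.units_mul_self, ParabolicQuandle.uPoly,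
      ParabolicQuandle.starPoly_prod_X_sub_C]
    simp
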